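/- Let $\Omega,\Omega'$ be finite sets, let $\mathcal X=(\Omega,S)$ and $\mathcal X'=(\Omega',S')$ be coherent configurations, let $\varphi:S\to S'$ be an algebraic isomorphism from $\mathcal X$ to $\mathcal X'$ (a bijection preserving the intersection numbers), and let $m\ge 2$. *$\mathrm{WL}_m$-equivalence.* For a tuple $x\in\Omega^m$, a point $\alpha$ and an index $i$, let $x_{i\leftarrow\alpha}$ be $x$ with its $i$-th entry replaced by $\alpha$; for $\sigma:\{1,\dots,m\}\to\{1,\dots,m\}$ put $x^\sigma=(x_{\sigma(1)},\dots,x_{\sigma(m)})$. Let $\mathrm{WL}_m(\mathcal X)$ be the partition of $\Omega^m$ computed by the $m$-dimensional Weisfeiler–Leman algorithm: initially $x$ and $y$ have the same colour if $(x_i,x_j)$ and $(y_i,y_j)$ lie in the same basis relation for all $i,j$; in each round the colour of $x$ is replaced by its old colour together with the multiset, over $\alpha\in\Omega$, of the vectors of old colours of $x_{1\leftarrow\alpha},\dots,x_{m\leftarrow\alpha}$; the classes are those of the stable colouring. It is an $m$-ary coherent configuration, i.e. for all classes $X_0,\dots,X_m$ the number $n^{X_0}_{X_1,\dots,X_m}$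 of $\alpha$ with $x_{i\leftarrow\alpha}\in X_i$ for all $i$ does not depend on $x\in X_0$, the set $X^\sigma$ is a class for every class $X$ and every $\sigma$, and the equality pattern of the entries is constant on each class. The configurations $\mathcal X$ and $\mathcal X'$ are *$\mathrm{WL}_m$-equivalent with respect to $\varphi$* if there is a bijection $\hat\varphi:\mathrm{WL}_m(\mathcal X)\to\mathrm{WL}_m(\mathcal X')$ that satisfies $\hat\varphi(X^\sigma)=\hat\varphi(X)^\sigma$ and $n^{X_0}_{X_1,\dots,X_m}=n^{\hat\varphi(X_0)}_{\hat\varphi(X_1),\dots,\hat\varphi(X_m)}$ for all classes and all $\sigma$ and whose $2$-projection extends $\varphi$: for every $s\in S$, $\varphi(s)$ is the union of the sets $\mathrm{pr}_2\,\hat\varphi(X)$ over all classes $X$ with $\mathrm{pr}_2X\subseteq s$, where $\mathrm{pr}_2$ is the projection to the first two coordinates. *The game $\mathsf C_{m+1}(\varphi)$.* There are $m+1$ pairs of pebbles. For $(x,x')\in\Omega^m\times\Omega'^m$, the game with initial configuration $(x,x')$ starts with the two copies of pebble $i$ on $x_i$ and $x'_i$ for $i=1,\dots,m$, and with the last pair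 off the board. In each round Spoiler picks up one of the $m+1$ pairs of pebbles (on or off the board) and chooses a set of points in $\Omega$ or in $\Omega'$; Duplicator answers with a set of the same size in the other configuration; Spoiler places one copy of the pebble on a point of Duplicator's set, and Duplicator places the other copy on a point of Spoiler's set. A position is won by Duplicator if matching the copies of each pebble defines a bijection $f:\Delta\to\Delta'$ between the sets of covered points of $\Omega$ and $\Omega'$ and $(s\cap\Delta^2)^f=\varphi(s)\cap\Delta'^2$ for all $s\in S$ with $s\cap\Delta^2\neq\varnothing$. Duplicator has a winning strategy if, whatever Spoiler does, Duplicator can win the position after every number of rounds (including the initial one). Let $T^m_\varphi\subseteq\Omega^m\times\Omega'^m$ be the set of pairs $(x,x')$ from which Duplicator has a winning strategy. **Theorem.** $\mathcal X$ and $\mathcal X'$ are $\mathrm{WL}_m$-equivalent with respect to $\varphi$ if and only if $T^m_\varphi$ has full support, i.e. every $x\in\Omega^m$ is in relation $T^m_\varphi$ with some $x'\in\Omega'^m$ and every $x'\in\Omega'^m$ is in that relation with some $x\in\Omega^m$. -/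

import Mathlib

/-- A coherent configuration on a finite set `Ω`: a partition `rels` of `Ω × Ω` into the
basis relations, satisfying the three axioms. -/
structure CoherentConfiguration (Ω : Type*) [Finite Ω] where
  rels : Set (Set (Ω × Ω))
  isPartition : Setoid.IsPartition rels
  diagonal_mem : ∃ U ⊆ rels, ⋃₀ U = Set.diagonal Ω
  swap_mem : ∀ s ∈ rels, Prod.swap ⁻¹' s ∈ rels
  coherent : ∀ r ∈ rels, ∀ s ∈ rels, ∀ t ∈ rels, ∀ p ∈ t, ∀ q ∈ t,
    {γ | (p.1, γ) ∈ r ∧ (γ, p.2) ∈ s}.ncard = {γ | (q.1, γ) ∈ r ∧ (γ, q.2) ∈ s}.ncard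

namespace CoherentConfiguration

variable {Ω Ω' : Type*} [Finite Ω] [Finite Ω']

theorem rel_nonempty (X : CoherentConfiguration Ω) (t : X.rels) : (t : Set (Ω × Ω)).Nonempty :=
  Setoid.nonempty_of_mem_partition X.isPartition t.2

/-- The intersection number `c_{rs}^t`: the number of `γ` with `(α, γ) ∈ r` and `(γ, β) ∈ s`,
for any `(α, β) ∈ t`. -/
noncomputable def intersectionNumber (X : CoherentConfiguration Ω) (r s t : X.rels) : ℕ :=
  {γ | ((X.rel_nonempty t).some.1, γ) ∈ (r : Set (Ω × Ω)) ∧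
    (γ, (X.rel_nonempty t).some.2) ∈ (s : Set (Ω × Ω))}.ncard

theorem intersectionNumber_eq (X : CoherentConfiguration Ω) (r s t : X.rels) {p : Ω × Ω}
    (hp : p ∈ (t : Set (Ω × Ω))) :
    X.intersectionNumber r s t =
      {γ | (p.1, γ) ∈ (r : Set (Ω × Ω)) ∧ (γ, p.2) ∈ (s : Set (Ω × Ω))}.ncard :=
  X.coherent r r.2 s s.2 t t.2 _ (X.rel_nonempty t).some_mem p hp

/-- An algebraic isomorphism: a bijection of the basis relations that preserves the
intersection numbers. -/
structure AlgIso (X : CoherentConfiguration Ω) (X' : CoherentConfiguration Ω') where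
  toEquiv : X.rels ≃ X'.rels
  map_intersectionNumber : ∀ r s t : X.rels,
    X'.intersectionNumber (toEquiv r) (toEquiv s) (toEquiv t) = X.intersectionNumber r s t

end CoherentConfiguration

/-- `n(x; K₁, …, K_m)`: the number of points `α` such that, for every `i`, replacing the `i`-th
entry of `x` by `α` gives a tuple in `K i`. -/
noncomputable def tupleCount {m : ℕ} {Ω : Type*} (x : Fin m → Ω)
    (K : Fin m → Set (Fin m → Ω)) : ℕ :=
  {α | ∀ i, Function.update x i α ∈ K i}.ncard

/-- An `m`-ary coherent configuration on a finite set `Ω`: a partition of `Ω^m` satisfying the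
three axioms. For a map `σ` of the index set to itself, `x^σ` is `x ∘ σ`. -/
structure MAryConfiguration (m : ℕ) (Ω : Type*) [Finite Ω] where
  classes : Set (Set (Fin m → Ω))
  isPartition : Setoid.IsPartition classes
  eq_iff : ∀ K ∈ classes, ∀ x ∈ K, ∀ y ∈ K, ∀ i j, x i = x j ↔ y i = y j
  act_mem : ∀ K ∈ classes, ∀ σ : Fin m → Fin m, (fun x : Fin m → Ω => x ∘ σ) '' K ∈ classes
  coherent : ∀ K₀ ∈ classes, ∀ K : Fin m → Set (Fin m → Ω), (∀ i, K i ∈ classes) →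
    ∀ x ∈ K₀, ∀ y ∈ K₀, tupleCount x K = tupleCount y K

namespace MAryConfiguration

variable {m : ℕ} {Ω Ω' : Type*} [Finite Ω] [Finite Ω']

theorem class_nonempty (Y : MAryConfiguration m Ω) (K : Y.classes) :
    (K : Set (Fin m → Ω)).Nonempty :=
  Setoid.nonempty_of_mem_partition Y.isPartition K.2

/-- The class `K^σ = {x^σ : x ∈ K}`. -/
def act (Y : MAryConfiguration m Ω) (σ : Fin m → Fin m) (K : Y.classes) : Y.classes :=
  ⟨(fun x : Fin m → Ω => x ∘ σ) '' K, Y.act_mem K K.2 σ⟩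

/-- The intersection number `n^{K₀}_{K₁, …, K_m}`: the value of `n(x₀; K₁, …, K_m)` at any
`x₀ ∈ K₀`. -/
noncomputable def intersectionNumber (Y : MAryConfiguration m Ω) (K₀ : Y.classes)
    (K : Fin m → Y.classes) : ℕ :=
  tupleCount (Y.class_nonempty K₀).some (fun i => (K i : Set (Fin m → Ω)))

theorem intersectionNumber_eq (Y : MAryConfiguration m Ω) (K₀ : Y.classes)
    (K : Fin m → Y.classes) {x : Fin m → Ω} (hx : x ∈ (K₀ : Set (Fin m → Ω))) :
    Y.intersectionNumber K₀ K = tupleCount x (fun i => (K i : Set (Fin m → Ω))) :=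
  Y.coherent K₀ K₀.2 _ (fun i => (K i).2) _ (Y.class_nonempty K₀).some_mem x hx

/-- An algebraic isomorphism of `m`-ary coherent configurations. -/
structure AlgIso (Y : MAryConfiguration m Ω) (Y' : MAryConfiguration m Ω') where
  toEquiv : Y.classes ≃ Y'.classes
  map_act : ∀ (K : Y.classes) (σ : Fin m → Fin m), toEquiv (Y.act σ K) = Y'.act σ (toEquiv K)
  map_intersectionNumber : ∀ (K₀ : Y.classes) (K : Fin m → Y.classes),
    Y.intersectionNumber K₀ K = Y'.intersectionNumber (toEquiv K₀) (fun i => toEquiv (K i))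

end MAryConfiguration

/-- The projection of a set of `m`-tuples to the first two coordinates. -/
def prTwo {m : ℕ} (hm : 2 ≤ m) {Ω : Type*} (K : Set (Fin m → Ω)) : Set (Ω × Ω) :=
  (fun x : Fin m → Ω => (x ⟨0, by omega⟩, x ⟨1, by omega⟩)) '' K

/-- The value at a relation `s` of the 2-projection `pr₂ K ↦ pr₂ (ψ K)` of an algebraic
isomorphism `ψ`, extended to unions: when `s` is a union of sets `pr₂ K`, it is the union of the
corresponding sets `pr₂ (ψ K)`. -/
def MAryConfiguration.AlgIso.twoProjection {m : ℕ} {Ω Ω' : Type*} [Finite Ω] [Finite Ω']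
    {Y : MAryConfiguration m Ω} {Y' : MAryConfiguration m Ω'}
    (ψ : MAryConfiguration.AlgIso Y Y') (hm : 2 ≤ m) (s : Set (Ω × Ω)) : Set (Ω' × Ω') :=
  ⋃ (K : Y.classes) (_ : prTwo hm (K : Set (Fin m → Ω)) ⊆ s),
    prTwo hm (ψ.toEquiv K : Set (Fin m → Ω'))

section WeisfeilerLeman

variable {Ω : Type*} [Finite Ω]

/-- The initial colouring of the `m`-dimensional Weisfeiler-Leman algorithm, as an equivalence
relation: `x` and `y` get the same colour if `(x i, x j)` and `(y i, y j)` lie in the same basis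
relation for all `i, j` (in particular, `x i = x j` if and only if `y i = y j`). -/
def wlInitial (m : ℕ) (X : CoherentConfiguration Ω) : Setoid (Fin m → Ω) where
  r x y := ∀ i j, ∀ s ∈ X.rels, (x i, x j) ∈ s ↔ (y i, y j) ∈ s
  iseqv := ⟨fun _ _ _ _ _ => Iff.rfl, fun h i j s hs => (h i j s hs).symm,
    fun h h' i j s hs => (h i j s hs).trans (h' i j s hs)⟩

/-- One refinement round: the new colour of `x` consists of its old colour and of the multiset,
over all points `α`, of the vectors of old colours of the tuples obtained from `x` by replacing
its `i`-th entry by `α`, for `i = 1, …, m`. -/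
def wlRefine {m : ℕ} (E : Setoid (Fin m → Ω)) : Setoid (Fin m → Ω) where
  r x y := E x y ∧ ∀ K : Fin m → Set (Fin m → Ω), (∀ i, K i ∈ E.classes) →
    tupleCount x K = tupleCount y K
  iseqv := ⟨fun x => ⟨E.refl x, fun _ _ => rfl⟩, fun h => ⟨E.symm h.1, fun K hK => (h.2 K hK).symm⟩,
    fun h h' => ⟨E.trans h.1 h'.1, fun K hK => (h.2 K hK).trans (h'.2 K hK)⟩⟩

/-- The colouring after `k` refinement rounds. -/
def wlRound (m : ℕ) (X : CoherentConfiguration Ω) : ℕ → Setoid (Fin m → Ω)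
  | 0 => wlInitial m X
  | k + 1 => wlRefine (wlRound m X k)

/-- The stable colouring: two tuples have the same colour if no round distinguishes them. -/
def wlStable (m : ℕ) (X : CoherentConfiguration Ω) : Setoid (Fin m → Ω) :=
  ⨅ k, wlRound m X k

variable {m : ℕ} {X : CoherentConfiguration Ω}

theorem wlStable_iff {x y : Fin m → Ω} : wlStable m X x y ↔ ∀ k, wlRound m X k x y := by
  refine ⟨fun h k => (iInf_le (wlRound m X) k) h, fun h => ?_⟩
  rintro _ ⟨k, rfl⟩
  exact h k

theorem wlRound_antitone : Antitone (wlRound m X) :=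
  antitone_nat_of_succ_le fun _ _ _ h => h.1

theorem wlStable_eq_of_apply {x y : Fin m → Ω} (h : wlStable m X x y) {i j : Fin m}
    (hij : x i = x j) : y i = y j := by
  obtain ⟨U, hU, hdiag⟩ := X.diagonal_mem
  have hx : (x i, x j) ∈ ⋃₀ U := by rw [hdiag]; exact hij
  obtain ⟨s, hs, hxs⟩ := hx
  have hy : (y i, y j) ∈ ⋃₀ U := ⟨s, hs, (wlStable_iff.1 h 0 i j s (hU hs)).1 hxs⟩
  rw [hdiag] at hy
  exact hy

theorem wlRefine_wlStable : wlRefine (wlStable m X) = wlStable m X := by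
  have hfin : Finite (Setoid (Fin m → Ω)) :=
    Finite.of_injective (fun E : Setoid (Fin m → Ω) => (fun x y => E x y)) fun E F h =>
      Setoid.ext fun x y => iff_of_eq (congrFun (congrFun h x) y)
  obtain ⟨N, hN⟩ := WellFoundedGT.monotone_chain_condition
    (⟨fun k => OrderDual.toDual (wlRound m X k), fun _ _ h => wlRound_antitone h⟩ :
      ℕ →o (Setoid (Fin m → Ω))ᵒᵈ)
  have hN' : ∀ k, N ≤ k → wlRound m X N = wlRound m X k := fun k hk => hN k hk
  have hst : wlStable m X = wlRound m X N := by
    refine le_antisymm (iInf_le _ N) (le_iInf fun k => ?_)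
    rcases le_total N k with hk | hk
    · exact (hN' k hk).le
    · exact wlRound_antitone hk
  rw [hst]
  exact (hN' (N + 1) (Nat.le_succ N)).symm

theorem wlStable_tupleCount {x y : Fin m → Ω} (h : wlStable m X x y)
    (K : Fin m → Set (Fin m → Ω)) (hK : ∀ i, K i ∈ (wlStable m X).classes) :
    tupleCount x K = tupleCount y K := by
  rw [← wlRefine_wlStable] at h
  exact h.2 K hK

theorem wlStable_exists_equiv {x y : Fin m → Ω} (h : wlStable m X x y) :
    ∃ f : Ω ≃ Ω, ∀ α i, wlStable m X (Function.update x i α) (Function.update y i (f α)) := by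
  classical
  let g : (Fin m → Ω) → Ω → Fin m → Quotient (wlStable m X) :=
    fun z α i => Quotient.mk _ (Function.update z i α)
  have key : ∀ c, Nonempty ({α // g x α = c} ≃ {α // g y α = c}) := by
    intro c
    have hc : ∀ z : Fin m → Ω, Nat.card {α // g z α = c} =
        tupleCount z (fun i => {w | wlStable m X w (c i).out}) := by
      intro z
      change Set.ncard {α | g z α = c} = _
      unfold tupleCount
      congr 1
      ext α
      simp only [Set.mem_ofPred_eq, funext_iff, g]
      refine forall_congr' fun i => ?_
      conv_lhs => rw [← Quotient.out_eq (c i)]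
      exact Quotient.eq
    have := wlStable_tupleCount h (fun i => {w | wlStable m X w (c i).out})
      (fun i => ⟨(c i).out, rfl⟩)
    rw [← hc, ← hc] at this
    exact Finite.card_eq.1 this
  refine ⟨Equiv.ofFiberEquiv fun c => (key c).some, fun α i => ?_⟩
  have := congrFun (Equiv.ofFiberEquiv_map (fun c => (key c).some) α) i
  exact (wlStable m X).symm (Quotient.exact this)

theorem wlStable_comp {x y : Fin m → Ω} (h : wlStable m X x y) (σ : Fin m → Fin m) :
    wlStable m X (x ∘ σ) (y ∘ σ) := by
  refine wlStable_iff.2 fun k => ?_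
  induction k generalizing x y σ with
  | zero => exact fun i j s hs => wlStable_iff.1 h 0 (σ i) (σ j) s hs
  | succ k ih =>
    refine ⟨ih h σ, fun K hK => ?_⟩
    obtain ⟨f, hf⟩ := wlStable_exists_equiv h
    have hstep : ∀ α i, wlRound m X k (Function.update (x ∘ σ) i α)
        (Function.update (y ∘ σ) i (f α)) := by
      intro α i
      by_cases hσ : Function.Injective σ
      · have hu : ∀ (z : Fin m → Ω) β, Function.update (z ∘ σ) i β =
            Function.update z (σ i) β ∘ σ := fun z β =>
          (Function.update_comp_eq_of_injective z hσ i β).symm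
        rw [hu, hu]
        exact ih (hf α (σ i)) σ
      · have hsurj : ¬ Function.Surjective σ := fun hs => hσ (Finite.injective_iff_surjective.2 hs)
        obtain ⟨j, hj⟩ := not_forall.1 hsurj
        have hu : ∀ (z : Fin m → Ω) β, Function.update (z ∘ σ) i β =
            Function.update z j β ∘ Function.update σ i j := by
          intro z β
          ext l
          by_cases hl : l = i
          · subst hl; simp
          · have : σ l ≠ j := fun e => hj ⟨l, e⟩
            simp [hl, this]
        rw [hu, hu]
        exact ih (hf α j) _
    have himg : {β | ∀ i, Function.update (y ∘ σ) i β ∈ K i} =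
        f '' {α | ∀ i, Function.update (x ∘ σ) i α ∈ K i} := by
      ext β
      obtain ⟨α, rfl⟩ := f.surjective β
      simp only [Set.mem_ofPred_eq, f.injective.mem_set_image]
      refine forall_congr' fun i => ?_
      obtain ⟨w, hw⟩ := hK i
      rw [hw]
      exact ⟨fun hh => (wlRound m X k).trans (hstep α i) hh,
        fun hh => (wlRound m X k).trans ((wlRound m X k).symm (hstep α i)) hh⟩
    unfold tupleCount
    rw [himg, Set.ncard_image_of_injective _ f.injective]

theorem wlStable_exists_change {w w' : Fin m → Ω} (h : wlStable m X w w') (x : Fin m → Ω)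
    (A : Finset (Fin m)) :
    ∃ u', wlStable m X (fun i => if i ∈ A then x i else w i) u' ∧ ∀ i ∉ A, u' i = w' i := by
  classical
  induction A using Finset.induction_on with
  | empty => exact ⟨w', by simpa using h, fun _ _ => rfl⟩
  | insert a A ha ih =>
    obtain ⟨u', hu, hu'⟩ := ih
    obtain ⟨f, hf⟩ := wlStable_exists_equiv hu
    refine ⟨Function.update u' a (f (x a)), ?_, fun i hi => ?_⟩
    · convert hf (x a) a using 2 with i
      by_cases hi : i = a
      · subst hi; simp
      · simp [hi]
    · rw [Finset.mem_insert, not_or] at hi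
      rw [Function.update_of_ne hi.1, hu' i hi.2]

theorem wlStable_exists_lift {x z : Fin m → Ω} {σ : Fin m → Fin m}
    (h : wlStable m X (x ∘ σ) z) : ∃ y, wlStable m X x y ∧ y ∘ σ = z := by
  classical
  let τ : Fin m → Fin m := fun i => if hi : ∃ j, σ j = i then hi.choose else i
  have hτ : ∀ j, σ (τ (σ j)) = σ j := by
    intro j
    have hj : ∃ l, σ l = σ j := ⟨j, rfl⟩
    simp only [τ, dif_pos hj]
    exact hj.choose_spec
  obtain ⟨y, hy, hy'⟩ := wlStable_exists_change (wlStable_comp h τ) x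
    (Finset.univ.filter fun i => ¬ ∃ j, σ j = i)
  refine ⟨y, ?_, ?_⟩
  · convert hy using 2 with i
    by_cases hi : ∃ j, σ j = i
    · obtain ⟨j, rfl⟩ := hi
      simp [hτ]
    · simp [not_exists.1 hi]
  · funext j
    have h1 : y (σ j) = z (τ (σ j)) := hy' (σ j) (by simp)
    rw [Function.comp_apply, h1]
    exact wlStable_eq_of_apply h (by simp [hτ])

/-- The `m`-ary coherent configuration `WL_m(X)` computed by the `m`-dimensional
Weisfeiler-Leman algorithm: the colour classes of the stable colouring. -/
def wlConfiguration (m : ℕ) (X : CoherentConfiguration Ω) : MAryConfiguration m Ω where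
  classes := (wlStable m X).classes
  isPartition := Setoid.isPartition_classes _
  eq_iff := by
    rintro K ⟨w, rfl⟩ x hx y hy i j
    have hxy : wlStable m X x y := (wlStable m X).trans hx ((wlStable m X).symm hy)
    exact ⟨wlStable_eq_of_apply hxy, wlStable_eq_of_apply ((wlStable m X).symm hxy)⟩
  act_mem := by
    rintro K ⟨w, rfl⟩ σ
    refine ⟨w ∘ σ, Set.ext fun z => ⟨?_, fun hz => ?_⟩⟩
    · rintro ⟨x, hx, rfl⟩
      exact wlStable_comp hx σ
    · obtain ⟨y, hy, rfl⟩ := wlStable_exists_lift ((wlStable m X).symm hz)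
      exact ⟨y, (wlStable m X).symm hy, rfl⟩
  coherent := by
    rintro K₀ ⟨w, rfl⟩ K hK x hx y hy
    exact wlStable_tupleCount ((wlStable m X).trans hx ((wlStable m X).symm hy)) K hK

/-- The 2-projection of `WL_m(X)` refines `X`: every basis relation of `X` is the union of the
projected classes it contains. -/
theorem sUnion_prTwo_wlConfiguration (hm : 2 ≤ m) {s : Set (Ω × Ω)} (hs : s ∈ X.rels) :
    ⋃ (K : (wlConfiguration m X).classes) (_ : prTwo hm (K : Set (Fin m → Ω)) ⊆ s),
      prTwo hm (K : Set (Fin m → Ω)) = s := by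
  refine Set.Subset.antisymm (Set.iUnion₂_subset fun _ h => h) fun p hp => ?_
  let x : Fin m → Ω := fun i => if i = ⟨0, by omega⟩ then p.1 else p.2
  have h0 : x ⟨0, by omega⟩ = p.1 := by simp [x]
  have h1 : x ⟨1, by omega⟩ = p.2 := by simp [x]
  refine Set.mem_iUnion₂.2 ⟨⟨{y | wlStable m X y x}, x, rfl⟩, ?_, x, (wlStable m X).refl x, ?_⟩
  · rintro _ ⟨y, hy, rfl⟩
    refine (wlStable_iff.1 hy 0 _ _ s hs).2 ?_
    rw [h0, h1]
    exact hp
  · simp only [h0, h1]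

end WeisfeilerLeman

/-- `X` and `X'` are `WL_m`-equivalent with respect to `φ`: some algebraic isomorphism
`WL_m(X) → WL_m(X')` has a 2-projection that extends `φ`. -/
def WLEquivalent {Ω Ω' : Type*} [Finite Ω] [Finite Ω'] {m : ℕ} (hm : 2 ≤ m)
    {X : CoherentConfiguration Ω} {X' : CoherentConfiguration Ω'}
    (φ : CoherentConfiguration.AlgIso X X') : Prop :=
  ∃ ψ : MAryConfiguration.AlgIso (wlConfiguration m X) (wlConfiguration m X'),
    ∀ s : X.rels, ψ.twoProjection hm (s : Set (Ω × Ω)) = (φ.toEquiv s : Set (Ω' × Ω'))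

section PebbleGame

variable {Ω Ω' : Type*} [Finite Ω] [Finite Ω'] {p : ℕ}

/-- A position of the game with `p` pairs of pebbles: each pair is either off the board (`none`),
or one copy lies on a point of `Ω` and the other copy on a point of `Ω'`. -/
abbrev PebblePosition (p : ℕ) (Ω Ω' : Type*) : Type _ := Fin p → Option (Ω × Ω')

/-- The points of `Ω` covered by pebbles. -/
def PebblePosition.left (P : PebblePosition p Ω Ω') : Set Ω := {α | ∃ i β, P i = some (α, β)}

/-- The points of `Ω'` covered by pebbles. -/
def PebblePosition.right (P : PebblePosition p Ω Ω') : Set Ω' := {β | ∃ i α, P i = some (α, β)}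

/-- The position `P` is won by Duplicator: matching the copies of each pebble gives a bijection
`f` between the covered sets `Δ` and `Δ'`, and `f` maps `s ∩ (Δ × Δ)` onto `φ(s) ∩ (Δ' × Δ')`
for every basis relation `s` that meets `Δ × Δ`. -/
def DuplicatorWinsRound {X : CoherentConfiguration Ω} {X' : CoherentConfiguration Ω'}
    (φ : CoherentConfiguration.AlgIso X X') (P : PebblePosition p Ω Ω') : Prop :=
  ∃ f : P.left ≃ P.right,
    (∀ (i : Fin p) (a : P.left) (b : P.right), P i = some (a.1, b.1) → f a = b) ∧
    ∀ s : X.rels, (∃ a b : P.left, (a.1, b.1) ∈ (s : Set (Ω × Ω))) →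
      Prod.map f f '' {q : P.left × P.left | (q.1.1, q.2.1) ∈ (s : Set (Ω × Ω))} =
        {q : P.right × P.right | (q.1.1, q.2.1) ∈ (φ.toEquiv s : Set (Ω' × Ω'))}

/-- Duplicator can play one round from `P` so that the next position is in `W`. In a round
Spoiler picks up a pair of pebbles `i` (on or off the board) and chooses a set of points on one
side; Duplicator answers with a set of the same size on the other side; Spoiler puts one copy of
pebble `i` on a point of Duplicator's set; Duplicator puts the other copy on a point of Spoiler's
set. -/
def DuplicatorCanReply (W : Set (PebblePosition p Ω Ω')) (P : PebblePosition p Ω Ω') : Prop :=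
  ∀ i : Fin p,
    (∀ A' : Set Ω', ∃ A : Set Ω, A.ncard = A'.ncard ∧
      ∀ a ∈ A, ∃ a' ∈ A', Function.update P i (some (a, a')) ∈ W) ∧
    (∀ A : Set Ω, ∃ A' : Set Ω', A'.ncard = A.ncard ∧
      ∀ a' ∈ A', ∃ a ∈ A, Function.update P i (some (a, a')) ∈ W)

/-- Duplicator has a winning strategy from `P`: there is a set of positions containing `P`, all
won by Duplicator, in which Duplicator can keep the game forever, whatever Spoiler does. -/
def DuplicatorHasWinningStrategy {X : CoherentConfiguration Ω} {X' : CoherentConfiguration Ω'}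
    (φ : CoherentConfiguration.AlgIso X X') (P : PebblePosition p Ω Ω') : Prop :=
  ∃ W : Set (PebblePosition p Ω Ω'), P ∈ W ∧
    ∀ Q ∈ W, DuplicatorWinsRound φ Q ∧ DuplicatorCanReply W Q

/-- The initial position given by a pair of `k`-tuples: pebble `i` lies on `x i` and `x' i` for
`i < k`, and the remaining pebbles are off the board. -/
def initialPosition (p : ℕ) {k : ℕ} (x : Fin k → Ω) (x' : Fin k → Ω') : PebblePosition p Ω Ω' :=
  fun i => if h : (i : ℕ) < k then some (x ⟨i, h⟩, x' ⟨i, h⟩) else none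

/-- The relation `T^m_φ` between `Ω^m` and `Ω'^m`: Duplicator wins the game with `m + 1` pebbles
from the initial position `(x, x')`. -/
def duplicatorRel (m : ℕ) {X : CoherentConfiguration Ω} {X' : CoherentConfiguration Ω'}
    (φ : CoherentConfiguration.AlgIso X X') : SetRel (Fin m → Ω) (Fin m → Ω') :=
  {q | DuplicatorHasWinningStrategy φ (initialPosition (m + 1) q.1 q.2)}

end PebbleGame

/-! Both sides of the theorem amount to the existence of a tuple bisimulation with full support
(`IsTupleBisimulation`): a relation between Ω^m and Ω'^m, compatible with equality of entries, with
φ and with index maps, such that for related x, x' a single bijection f : Ω ≃ Ω' keeps them related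
when the i-th entries are replaced by α and f α, for every α and i.

If ψ witnesses WL_m-equivalence, lying in corresponding classes is such a relation, because equal
intersection numbers yield f. Any bisimulation gives Duplicator a strategy
(`IsTupleBisimulation.mem_duplicatorRel`): keep all m-tuples drawn from the m + 1 pebbled points
related, and answer sets by their images or preimages under f.

Conversely, `duplicatorRel` is itself a bisimulation: pebbles are interchangeable, and Hall's
theorem merges the answers to all of Spoiler's sets into one bijection. A bisimulation with full
support matches the colours of every refinement round, hence the stable classes, and its bijections
preserve the intersection numbers (`IsTupleBisimulation.exists_algIso`). -/

section Bisimulation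

set_option linter.unusedSectionVars false

variable {Ω Ω' : Type*} [Finite Ω] [Finite Ω']
  {X : CoherentConfiguration Ω} {X' : CoherentConfiguration Ω'}

/-! ### Basis relations under an algebraic isomorphism -/

namespace CoherentConfiguration

theorem exists_mem_rel (X : CoherentConfiguration Ω) (q : Ω × Ω) :
    ∃ s : X.rels, q ∈ (s : Set (Ω × Ω)) := by
  obtain ⟨s, ⟨hs, hq⟩, -⟩ := X.isPartition.2 q
  exact ⟨⟨s, hs⟩, hq⟩

theorem rel_eq_of_mem {X : CoherentConfiguration Ω} {s t : X.rels} {q : Ω × Ω}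
    (hs : q ∈ (s : Set (Ω × Ω))) (ht : q ∈ (t : Set (Ω × Ω))) : s = t :=
  Subtype.ext (Setoid.eq_of_mem_eqv_class X.isPartition.2 s.2 hs t.2 ht)

/-- Since basis relations partition the pairs and φ is injective, the one relation containing `q`
decides all the others. -/
theorem AlgIso.mem_iff_of_imp (φ : AlgIso X X') {q : Ω × Ω} {q' : Ω' × Ω'}
    (h : ∀ s : X.rels, q ∈ (s : Set (Ω × Ω)) → q' ∈ (φ.toEquiv s : Set (Ω' × Ω'))) (s : X.rels) :
    q ∈ (s : Set (Ω × Ω)) ↔ q' ∈ (φ.toEquiv s : Set (Ω' × Ω')) := by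
  refine ⟨h s, fun hs => ?_⟩
  obtain ⟨t, ht⟩ := X.exists_mem_rel q
  rwa [φ.toEquiv.injective (rel_eq_of_mem hs (h t ht))]

end CoherentConfiguration

/-! ### Tuples in corresponding classes -/

namespace MAryConfiguration

variable {m : ℕ} {Y : MAryConfiguration m Ω} {Y' : MAryConfiguration m Ω'}

theorem exists_mem_class (Y : MAryConfiguration m Ω) (x : Fin m → Ω) :
    ∃ K : Y.classes, x ∈ (K : Set (Fin m → Ω)) := by
  obtain ⟨K, ⟨hK, hx⟩, -⟩ := Y.isPartition.2 x
  exact ⟨⟨K, hK⟩, hx⟩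

theorem class_eq_of_mem {K L : Y.classes} {x : Fin m → Ω}
    (hK : x ∈ (K : Set (Fin m → Ω))) (hL : x ∈ (L : Set (Fin m → Ω))) : K = L :=
  Subtype.ext (Setoid.eq_of_mem_eqv_class Y.isPartition.2 K.2 hK L.2 hL)

/-- Entries `i` and `j` agree on a class exactly when the class is fixed by the map sending `j`
to `i` and fixing the other indices. -/
theorem apply_eq_iff_act_eq {K : Y.classes} {x : Fin m → Ω} (hx : x ∈ (K : Set (Fin m → Ω)))
    (i j : Fin m) : x i = x j ↔ Y.act (Function.update id j i) K = K := by
  constructor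
  · intro h
    refine class_eq_of_mem (x := x) ⟨x, hx, ?_⟩ hx
    funext l
    by_cases hl : l = j
    · subst hl; simpa using h
    · simp [hl]
  · intro h
    have hx' : x ∈ (Y.act (Function.update id j i) K : Set (Fin m → Ω)) := by rwa [h]
    obtain ⟨y, -, rfl⟩ := hx'
    by_cases hij : i = j
    · rw [hij]
    · simp [hij]

/-- Two tuples are matched by an algebraic isomorphism when their classes correspond. -/
def AlgIso.Matches (ψ : AlgIso Y Y') (x : Fin m → Ω) (x' : Fin m → Ω') : Prop :=
  ∃ K : Y.classes, x ∈ (K : Set (Fin m → Ω)) ∧ x' ∈ (ψ.toEquiv K : Set (Fin m → Ω'))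

theorem AlgIso.Matches.comp {ψ : AlgIso Y Y'} {x : Fin m → Ω} {x' : Fin m → Ω'}
    (h : ψ.Matches x x') (σ : Fin m → Fin m) : ψ.Matches (x ∘ σ) (x' ∘ σ) := by
  obtain ⟨K, hx, hx'⟩ := h
  refine ⟨Y.act σ K, ⟨x, hx, rfl⟩, ?_⟩
  rw [ψ.map_act]
  exact ⟨x', hx', rfl⟩

/-- An algebraic isomorphism is not assumed to preserve equality patterns. These are encoded by
which index maps fix a class, and ψ commutes with index maps. -/
theorem AlgIso.Matches.apply_eq_iff {ψ : AlgIso Y Y'} {x : Fin m → Ω} {x' : Fin m → Ω'}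
    (h : ψ.Matches x x') (i j : Fin m) : x i = x j ↔ x' i = x' j := by
  obtain ⟨K, hx, hx'⟩ := h
  rw [apply_eq_iff_act_eq hx, apply_eq_iff_act_eq hx', ← ψ.map_act, ψ.toEquiv.apply_eq_iff_eq]

/-- Colour each point by the vector of classes obtained by substituting it in each position, pulling
classes of `Y'` back along ψ. The fibres are counted by intersection numbers, so they have equal
sizes and bijections between them glue to `f`. -/
theorem AlgIso.Matches.exists_equiv {ψ : AlgIso Y Y'} {x : Fin m → Ω} {x' : Fin m → Ω'}
    (h : ψ.Matches x x') :
    ∃ f : Ω ≃ Ω', ∀ α i, ψ.Matches (Function.update x i α) (Function.update x' i (f α)) := by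
  obtain ⟨K₀, hx, hx'⟩ := h
  choose c hc using Y.exists_mem_class
  choose c' hc' using Y'.exists_mem_class
  let g : Ω → Fin m → Y.classes := fun α i => c (Function.update x i α)
  let g' : Ω' → Fin m → Y.classes := fun α i => ψ.toEquiv.symm (c' (Function.update x' i α))
  have key : ∀ K, Nonempty ({α // g α = K} ≃ {α // g' α = K}) := by
    intro K
    have h1 : Nat.card {α // g α = K} = tupleCount x fun i => (K i : Set (Fin m → Ω)) := by
      change Set.ncard {α | g α = K} = _
      unfold tupleCount
      congr 1
      ext α
      simp only [Set.mem_ofPred_eq, funext_iff, g]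
      exact forall_congr' fun i => ⟨fun e => e ▸ hc _, fun e => class_eq_of_mem (hc _) e⟩
    have h2 : Nat.card {α // g' α = K} =
        tupleCount x' fun i => (ψ.toEquiv (K i) : Set (Fin m → Ω')) := by
      change Set.ncard {α | g' α = K} = _
      unfold tupleCount
      congr 1
      ext α
      simp only [Set.mem_ofPred_eq, funext_iff, g', Equiv.symm_apply_eq]
      exact forall_congr' fun i => ⟨fun e => e ▸ hc' _, fun e => class_eq_of_mem (hc' _) e⟩
    refine Finite.card_eq.1 ?_
    rw [h1, h2, ← Y.intersectionNumber_eq K₀ K hx, ← Y'.intersectionNumber_eq _ _ hx',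
      ψ.map_intersectionNumber]
  refine ⟨Equiv.ofFiberEquiv fun K => (key K).some, fun α i => ⟨_, hc _, ?_⟩⟩
  have := congrFun (Equiv.ofFiberEquiv_map (fun K => (key K).some) α) i
  simp only [g, g', Equiv.symm_apply_eq] at this
  rw [← this]
  exact hc' _

theorem AlgIso.Matches.exists_right (ψ : AlgIso Y Y') (x : Fin m → Ω) : ∃ x', ψ.Matches x x' := by
  obtain ⟨K, hK⟩ := Y.exists_mem_class x
  exact ⟨_, K, hK, (Y'.class_nonempty (ψ.toEquiv K)).some_mem⟩

theorem AlgIso.Matches.exists_left (ψ : AlgIso Y Y') (x' : Fin m → Ω') :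
    ∃ x, ψ.Matches x x' := by
  obtain ⟨K, hK⟩ := Y'.exists_mem_class x'
  exact ⟨_, ψ.toEquiv.symm K, (Y.class_nonempty _).some_mem, by rwa [ψ.toEquiv.apply_symm_apply]⟩

end MAryConfiguration

/-! ### Tuple bisimulations -/

/-- A relation between `Ω^m` and `Ω'^m` that respects equality of entries and basis relations,
is invariant under maps of the index set, and has the back-and-forth property for replacing one
entry. -/
structure IsTupleBisimulation {m : ℕ} (φ : CoherentConfiguration.AlgIso X X')
    (R : (Fin m → Ω) → (Fin m → Ω') → Prop) : Prop where
  eq_iff : ∀ {x x'}, R x x' → ∀ i j, x i = x j ↔ x' i = x' j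
  rel_iff : ∀ {x x'}, R x x' → ∀ i j, ∀ s : X.rels,
    (x i, x j) ∈ (s : Set (Ω × Ω)) ↔ (x' i, x' j) ∈ (φ.toEquiv s : Set (Ω' × Ω'))
  comp : ∀ {x x'}, R x x' → ∀ σ : Fin m → Fin m, R (x ∘ σ) (x' ∘ σ)
  exists_equiv : ∀ {x x'}, R x x' →
    ∃ f : Ω ≃ Ω', ∀ α i, R (Function.update x i α) (Function.update x' i (f α))

variable {m : ℕ} {φ : CoherentConfiguration.AlgIso X X'}

theorem prTwo_wlClass_subset (hm : 2 ≤ m) {K : (wlConfiguration m X).classes} {x : Fin m → Ω}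
    (hx : x ∈ (K : Set (Fin m → Ω))) {s : X.rels}
    (hs : (x ⟨0, by omega⟩, x ⟨1, by omega⟩) ∈ (s : Set (Ω × Ω))) :
    prTwo hm (K : Set (Fin m → Ω)) ⊆ s := by
  obtain ⟨_, w, rfl⟩ := K
  rintro _ ⟨y, hy, rfl⟩
  exact (wlStable_iff.1 ((wlStable m X).trans hx ((wlStable m X).symm hy)) 0 _ _ s s.2).1 hs

/-- The hypothesis on the 2-projection sees only the first two coordinates; an index map brings any
`i`, `j` there. -/
theorem isTupleBisimulation_matches (hm : 2 ≤ m)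
    (ψ : MAryConfiguration.AlgIso (wlConfiguration m X) (wlConfiguration m X'))
    (hψ : ∀ s : X.rels, ψ.twoProjection hm (s : Set (Ω × Ω)) = (φ.toEquiv s : Set (Ω' × Ω'))) :
    IsTupleBisimulation φ ψ.Matches where
  eq_iff h := h.apply_eq_iff
  comp h := h.comp
  exists_equiv h := h.exists_equiv
  rel_iff {x x'} h i j := by
    refine φ.mem_iff_of_imp fun s hs => ?_
    have h' := h.comp fun l => if l = ⟨0, by omega⟩ then i else j
    obtain ⟨K, hx, hx'⟩ := h'
    rw [← hψ s]
    refine Set.mem_iUnion₂.2 ⟨K, prTwo_wlClass_subset hm hx (by simpa using hs), _, hx', ?_⟩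
    simp

/-! ### Winning positions -/

/-- The winning condition is local: it concerns two pebbles at a time. It therefore passes to
positions with fewer or rearranged pebbles. -/
theorem duplicatorWinsRound_iff {p : ℕ} {P : PebblePosition p Ω Ω'} :
    DuplicatorWinsRound φ P ↔ ∀ i j a a' b b', P i = some (a, a') → P j = some (b, b') →
      (a = b ↔ a' = b') ∧ ∀ s : X.rels,
        (a, b) ∈ (s : Set (Ω × Ω)) ↔ (a', b') ∈ (φ.toEquiv s : Set (Ω' × Ω')) := by
  constructor
  · rintro ⟨f, hf, hs⟩ i j a a' b b' hi hj
    have ha := hf i ⟨a, i, a', hi⟩ ⟨a', i, a, hi⟩ hi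
    have hb := hf j ⟨b, j, b', hj⟩ ⟨b', j, b, hj⟩ hj
    refine ⟨?_, φ.mem_iff_of_imp fun s hab => ?_⟩
    · have := f.apply_eq_iff_eq (x := ⟨a, i, a', hi⟩) (y := ⟨b, j, b', hj⟩)
      rw [ha, hb] at this
      exact Subtype.ext_iff.symm.trans (this.symm.trans Subtype.ext_iff)
    · have h := (hs s ⟨⟨a, i, a', hi⟩, ⟨b, j, b', hj⟩, hab⟩).subset
        ⟨(⟨a, i, a', hi⟩, ⟨b, j, b', hj⟩), hab, rfl⟩
      simpa [ha, hb] using h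
  · intro h
    have hex : ∀ a : P.left, ∃ b : P.right, ∃ i, P i = some (a.1, b.1) := by
      rintro ⟨a, i, b, hi⟩
      exact ⟨⟨b, i, a, hi⟩, i, hi⟩
    choose F hF using hex
    have hFeq : ∀ i (a : P.left) (b : P.right), P i = some (a.1, b.1) → F a = b := by
      intro i a b hi
      obtain ⟨j, hj⟩ := hF a
      exact Subtype.ext ((h _ _ _ _ _ _ hj hi).1.1 rfl)
    have hbij : Function.Bijective F := by
      refine ⟨fun a b hab => ?_, ?_⟩
      · obtain ⟨i, hi⟩ := hF a
        obtain ⟨j, hj⟩ := hF b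
        exact Subtype.ext ((h _ _ _ _ _ _ hi hj).1.2 (congrArg Subtype.val hab))
      · rintro ⟨b, i, a, hi⟩
        exact ⟨⟨a, i, b, hi⟩, hFeq i _ _ hi⟩
    refine ⟨Equiv.ofBijective F hbij, hFeq, fun s _ => Set.ext fun q => ?_⟩
    have hrel : ∀ a b : P.left, (a.1, b.1) ∈ (s : Set (Ω × Ω)) ↔
        ((F a).1, (F b).1) ∈ (φ.toEquiv s : Set (Ω' × Ω')) := by
      intro a b
      obtain ⟨i, hi⟩ := hF a
      obtain ⟨j, hj⟩ := hF b
      exact (h _ _ _ _ _ _ hi hj).2 s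
    constructor
    · rintro ⟨⟨a, b⟩, hab, rfl⟩
      exact (hrel a b).1 hab
    · obtain ⟨a', b'⟩ := q
      obtain ⟨a, rfl⟩ := hbij.2 a'
      obtain ⟨b, rfl⟩ := hbij.2 b'
      exact fun hab => ⟨(a, b), (hrel a b).2 hab, rfl⟩

/-- `P` is obtained from `Q` by taking pebbles off the board. -/
def PebblePosition.IsSub {p : ℕ} (P Q : PebblePosition p Ω Ω') : Prop :=
  ∀ i c, P i = some c → Q i = some c

theorem PebblePosition.IsSub.update {p : ℕ} {P Q : PebblePosition p Ω Ω'} (h : P.IsSub Q)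
    (i : Fin p) (c : Option (Ω × Ω')) : IsSub (Function.update P i c) (Function.update Q i c) := by
  intro j d hd
  by_cases hj : j = i
  · subst hj; simpa using hd
  · rw [Function.update_of_ne hj] at hd ⊢
    exact h j d hd

/-- A winning strategy survives taking pebbles off the board and moving pebbles onto other
pebbles. -/
theorem DuplicatorHasWinningStrategy.of_isSub_comp {p : ℕ} {P Q : PebblePosition p Ω Ω'}
    (hP : DuplicatorHasWinningStrategy φ P) (σ : Fin p → Fin p) (hQ : Q.IsSub (P ∘ σ)) :
    DuplicatorHasWinningStrategy φ Q := by
  obtain ⟨W, hPW, hW⟩ := hP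
  refine ⟨{Q | ∃ P ∈ W, ∃ σ : Fin p → Fin p, PebblePosition.IsSub Q (P ∘ σ)}, ⟨P, hPW, σ, hQ⟩, ?_⟩
  rintro Q ⟨P, hPW, σ, hQ⟩
  refine ⟨duplicatorWinsRound_iff.2 fun i j a a' b b' hi hj =>
    duplicatorWinsRound_iff.1 (hW P hPW).1 _ _ _ _ _ _ (hQ _ _ hi) (hQ _ _ hj), fun i => ?_⟩
  -- A move of pebble `i` in `Q` is simulated by a move of pebble `j` in `P`. If `σ` is injective,
  -- only `i` copies `σ i`, so `j = σ i`; otherwise some pebble `j` of `P` is copied by none, is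
  -- free to move, and `i` is redirected to it.
  obtain ⟨j, τ, hτ⟩ : ∃ (j : Fin p) (τ : Fin p → Fin p), ∀ c,
      Function.update (P ∘ σ) i c = Function.update P j c ∘ τ := by
    by_cases hσ : Function.Injective σ
    · exact ⟨σ i, σ, fun c => (Function.update_comp_eq_of_injective P hσ i c).symm⟩
    · have hsurj : ¬ Function.Surjective σ := fun hs => hσ (Finite.injective_iff_surjective.2 hs)
      obtain ⟨j, hj⟩ := not_forall.1 hsurj
      refine ⟨j, Function.update σ i j, fun c => ?_⟩
      ext1 l
      by_cases hl : l = i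
      · subst hl; simp
      · have : σ l ≠ j := fun e => hj ⟨l, e⟩
        simp [hl, this]
  have key : ∀ c, Function.update P j c ∈ W →
      Function.update Q i c ∈
        {Q | ∃ P ∈ W, ∃ σ : Fin p → Fin p, PebblePosition.IsSub Q (P ∘ σ)} :=
    fun c hc => ⟨_, hc, τ, hτ c ▸ hQ.update i c⟩
  obtain ⟨h1, h2⟩ := (hW P hPW).2 j
  refine ⟨fun A' => ?_, fun A => ?_⟩
  · obtain ⟨A, hA, h⟩ := h1 A'
    exact ⟨A, hA, fun a ha => (h a ha).imp fun a' h' => ⟨h'.1, key _ h'.2⟩⟩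
  · obtain ⟨A', hA, h⟩ := h2 A
    exact ⟨A', hA, fun a ha => (h a ha).imp fun a' h' => ⟨h'.1, key _ h'.2⟩⟩

theorem DuplicatorHasWinningStrategy.wins {p : ℕ} {P : PebblePosition p Ω Ω'}
    (hP : DuplicatorHasWinningStrategy φ P) : DuplicatorWinsRound φ P := by
  obtain ⟨W, hPW, hW⟩ := hP
  exact (hW P hPW).1

/-- The winning positions together form one safe set, so replies need not refer to a particular
strategy. -/
theorem DuplicatorHasWinningStrategy.canReply {p : ℕ} {P : PebblePosition p Ω Ω'}
    (hP : DuplicatorHasWinningStrategy φ P) :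
    DuplicatorCanReply {Q | DuplicatorHasWinningStrategy φ Q} P := by
  obtain ⟨W, hPW, hW⟩ := hP
  intro i
  obtain ⟨h1, h2⟩ := (hW P hPW).2 i
  refine ⟨fun A' => ?_, fun A => ?_⟩
  · obtain ⟨A, hA, h⟩ := h1 A'
    exact ⟨A, hA, fun a ha => (h a ha).imp fun a' h' => ⟨h'.1, W, h'.2, hW⟩⟩
  · obtain ⟨A', hA, h⟩ := h2 A
    exact ⟨A', hA, fun a ha => (h a ha).imp fun a' h' => ⟨h'.1, W, h'.2, hW⟩⟩

/-- By Hall's theorem, the replies to all choices of Spoiler can be collected in one bijection. -/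
theorem DuplicatorCanReply.exists_equiv {p : ℕ} {W : Set (PebblePosition p Ω Ω')}
    {P : PebblePosition p Ω Ω'} (h : DuplicatorCanReply W P) (i : Fin p) :
    ∃ f : Ω ≃ Ω', ∀ α, Function.update P i (some (α, f α)) ∈ W := by
  classical
  have := Fintype.ofFinite Ω
  have := Fintype.ofFinite Ω'
  let t : Ω → Finset Ω' := fun α =>
    Finset.univ.filter fun β => Function.update P i (some (α, β)) ∈ W
  -- Hall's condition: Duplicator's answer to `A` has the size of `A` and lies in its neighbourhood.
  have hall : ∀ A : Finset Ω, A.card ≤ (A.biUnion t).card := by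
    intro A
    obtain ⟨A', hcard, hA'⟩ := (h i).2 A
    rw [Set.ncard_coe_finset] at hcard
    rw [← hcard, ← Set.ncard_coe_finset]
    refine Set.ncard_le_ncard (fun a' ha' => ?_) (Set.toFinite _)
    obtain ⟨a, ha, hW⟩ := hA' a' ha'
    simp only [Finset.coe_biUnion, Set.mem_iUnion]
    exact ⟨a, ha, by simpa [t] using hW⟩
  obtain ⟨f, hf, hft⟩ := (Finset.all_card_le_biUnion_card_iff_exists_injective t).1 hall
  -- Spoiler's choice of all of `Ω'` forces an equally large set in `Ω`, so the injection from
  -- Hall's theorem is onto.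
  have hcard : Nat.card Ω' ≤ Nat.card Ω := by
    obtain ⟨A, hA, -⟩ := (h i).1 Set.univ
    rw [← Set.ncard_univ Ω', ← hA, ← Set.ncard_univ Ω]
    exact Set.ncard_le_ncard (Set.subset_univ _)
  have hbij : Function.Bijective f := by
    rw [Fintype.bijective_iff_injective_and_card]
    refine ⟨hf, le_antisymm (Fintype.card_le_of_injective f hf) ?_⟩
    simpa [Nat.card_eq_fintype_card] using hcard
  exact ⟨Equiv.ofBijective f hbij, fun α => by simpa [t] using hft α⟩

/-! ### Winning strategies form a bisimulation -/

theorem initialPosition_castSucc (x : Fin m → Ω) (x' : Fin m → Ω') (i : Fin m) :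
    initialPosition (m + 1) x x' i.castSucc = some (x i, x' i) := by
  simp [initialPosition]

theorem isSub_initialPosition {x : Fin m → Ω} {x' : Fin m → Ω'}
    {Q : PebblePosition (m + 1) Ω Ω'} (h : ∀ i : Fin m, Q i.castSucc = some (x i, x' i)) :
    (initialPosition (m + 1) x x').IsSub Q := by
  intro i c hc
  induction i using Fin.lastCases with
  | last => simp [initialPosition] at hc
  | cast i => rw [h, ← initialPosition_castSucc, hc]

/-- The spare pebble makes one bijection serve all positions: it is placed on `(α, f α)` before `i`
is chosen, and pebble `i` then joins it. -/
theorem isTupleBisimulation_duplicatorRel (m : ℕ) (φ : CoherentConfiguration.AlgIso X X') :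
    IsTupleBisimulation φ fun x x' => (x, x') ∈ duplicatorRel m φ where
  eq_iff {x x'} h i j := (duplicatorWinsRound_iff.1 h.wins _ _ _ _ _ _
    (initialPosition_castSucc x x' i) (initialPosition_castSucc x x' j)).1
  rel_iff {x x'} h i j := (duplicatorWinsRound_iff.1 h.wins _ _ _ _ _ _
    (initialPosition_castSucc x x' i) (initialPosition_castSucc x x' j)).2
  comp {x x'} h σ := by
    refine DuplicatorHasWinningStrategy.of_isSub_comp h
      (Fin.lastCases (Fin.last m) fun i => (σ i).castSucc) (isSub_initialPosition fun i => ?_)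
    simp [initialPosition_castSucc]
  exists_equiv {x x'} h := by
    obtain ⟨f, hf⟩ := (DuplicatorHasWinningStrategy.canReply h).exists_equiv (Fin.last m)
    refine ⟨f, fun α i => ?_⟩
    refine DuplicatorHasWinningStrategy.of_isSub_comp (hf α)
      (Function.update id i.castSucc (Fin.last m)) (isSub_initialPosition fun j => ?_)
    by_cases hj : j = i
    · subst hj; simp
    · have : j.castSucc ≠ Fin.last m := Fin.castSucc_ne_last j
      simp [hj, this, initialPosition_castSucc]

/-! ### From bisimulations to winning strategies -/

/-- A map to `Fin (m + 1)` that misses an index other than `i` factors through the map obtained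
from the enumeration of the indices other than `i` by redirecting one entry to `i`. -/
theorem exists_eq_update_succAbove_comp {i k : Fin (m + 1)} (hki : k ≠ i)
    {τ : Fin m → Fin (m + 1)} (hk : ∀ l, τ l ≠ k) :
    ∃ (j : Fin m) (σ : Fin m → Fin m), τ = Function.update i.succAbove j i ∘ σ := by
  obtain ⟨j, rfl⟩ := Fin.exists_succAbove_eq hki
  have h : ∀ l, ∃ q, Function.update i.succAbove j i q = τ l := by
    intro l
    by_cases hl : τ l = i
    · exact ⟨j, by simp [hl]⟩
    · obtain ⟨q, hq⟩ := Fin.exists_succAbove_eq hl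
      have hqj : q ≠ j := by
        rintro rfl
        exact hk l hq.symm
      exact ⟨q, by rw [Function.update_of_ne hqj, hq]⟩
  choose σ hσ using h
  exact ⟨j, σ, funext fun l => (hσ l).symm⟩

theorem update_comp_update_succAbove {A : Type*} (z : Fin (m + 1) → A) (i : Fin (m + 1))
    (j : Fin m) (α : A) : Function.update z i α ∘ Function.update i.succAbove j i =
      Function.update (z ∘ i.succAbove) j α := by
  ext1 l
  by_cases hl : l = j
  · subst hl; simp
  · simp [hl]

theorem IsTupleBisimulation.exists_equiv_update {R : (Fin m → Ω) → (Fin m → Ω') → Prop}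
    (hR : IsTupleBisimulation φ R) {z : Fin (m + 1) → Ω} {z' : Fin (m + 1) → Ω'}
    (h : ∀ τ : Fin m → Fin (m + 1), R (z ∘ τ) (z' ∘ τ)) (i : Fin (m + 1)) :
    ∃ f : Ω ≃ Ω', ∀ α, ∀ τ : Fin m → Fin (m + 1),
      R (Function.update z i α ∘ τ) (Function.update z' i (f α) ∘ τ) := by
  -- With pebble `i` lifted, the remaining `m` pebbles form a related pair of tuples, whose
  -- bijection is used.
  obtain ⟨f, hf⟩ := hR.exists_equiv (h i.succAbove)
  refine ⟨f, fun α τ => ?_⟩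
  obtain ⟨k, hk⟩ : ∃ k, ∀ l, τ l ≠ k := by
    by_contra! hτ
    simpa using Fintype.card_le_of_surjective τ hτ
  -- If `τ` misses `i`, the move is invisible to it. Otherwise the entry of the missed index `k` can
  -- be overwritten by the new point, and this is a one-entry replacement in the tuple without `i`.
  by_cases hki : k = i
  · subst hki
    have hu : Function.update z k α ∘ τ = z ∘ τ :=
      funext fun l => Function.update_of_ne (hk l) _ _
    have hu' : Function.update z' k (f α) ∘ τ = z' ∘ τ :=
      funext fun l => Function.update_of_ne (hk l) _ _
    rw [hu, hu']
    exact h τ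
  · obtain ⟨j, σ, rfl⟩ := exists_eq_update_succAbove_comp hki hk
    rw [← Function.comp_assoc, ← Function.comp_assoc, update_comp_update_succAbove,
      update_comp_update_succAbove]
    exact hR.comp (hf α j) σ

theorem IsTupleBisimulation.mem_duplicatorRel {R : (Fin m → Ω) → (Fin m → Ω') → Prop}
    (hR : IsTupleBisimulation φ R) (hm : 2 ≤ m) {x : Fin m → Ω} {x' : Fin m → Ω'} (h : R x x') :
    (x, x') ∈ duplicatorRel m φ := by
  -- The invariant lets `Q` have pebbles off the board, as long as it extends to a full placement
  -- all of whose `m`-tuples are related.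
  refine ⟨{Q | ∃ (z : Fin (m + 1) → Ω) (z' : Fin (m + 1) → Ω'),
    (∀ τ : Fin m → Fin (m + 1), R (z ∘ τ) (z' ∘ τ)) ∧
      PebblePosition.IsSub Q fun i => some (z i, z' i)}, ?_, ?_⟩
  · let ρ : Fin (m + 1) → Fin m := Fin.lastCases ⟨0, by omega⟩ id
    exact ⟨x ∘ ρ, x' ∘ ρ, fun τ => hR.comp h (ρ ∘ τ),
      isSub_initialPosition fun i => by simp [ρ]⟩
  · rintro Q ⟨z, z', hz, hQ⟩
    constructor
    · refine duplicatorWinsRound_iff.2 fun i j a a' b b' hi hj => ?_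
      have hi' := hQ i _ hi
      have hj' := hQ j _ hj
      simp only [Option.some.injEq, Prod.mk.injEq] at hi' hj'
      obtain ⟨rfl, rfl⟩ := hi'
      obtain ⟨rfl, rfl⟩ := hj'
      -- As `m ≥ 2`, any two pebbles occur in a common `m`-tuple.
      have h' := hz fun l => if l = ⟨0, by omega⟩ then i else j
      have h1 := hR.eq_iff h' ⟨0, by omega⟩ ⟨1, by omega⟩
      have h2 := hR.rel_iff h' ⟨0, by omega⟩ ⟨1, by omega⟩
      simp only [Function.comp_apply, Fin.mk.injEq, one_ne_zero, if_true, if_false] at h1 h2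
      exact ⟨h1, h2⟩
    · intro i
      obtain ⟨f, hf⟩ := hR.exists_equiv_update hz i
      have key : ∀ α, Function.update Q i (some (α, f α)) ∈
          {Q | ∃ (z : Fin (m + 1) → Ω) (z' : Fin (m + 1) → Ω'),
            (∀ τ : Fin m → Fin (m + 1), R (z ∘ τ) (z' ∘ τ)) ∧
              PebblePosition.IsSub Q fun i => some (z i, z' i)} := by
        intro α
        refine ⟨_, _, hf α, ?_⟩
        convert hQ.update i (some (α, f α)) using 1
        ext1 l
        by_cases hl : l = i
        · subst hl; simp
        · simp [hl]
      refine ⟨fun A' => ⟨f ⁻¹' A', ?_, fun a ha => ⟨f a, ha, key a⟩⟩,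
        fun A => ⟨f '' A, Set.ncard_image_of_injective _ f.injective, ?_⟩⟩
      · rw [← Set.ncard_image_of_injective _ f.injective, f.image_preimage]
      · rintro _ ⟨a, ha, rfl⟩
        exact ⟨a, ha, key a⟩

/-! ### From bisimulations to algebraic isomorphisms -/

theorem tupleCount_eq_of_equiv {x : Fin m → Ω} {x' : Fin m → Ω'} {K : Fin m → Set (Fin m → Ω)}
    {K' : Fin m → Set (Fin m → Ω')} (f : Ω ≃ Ω')
    (hf : ∀ α i, Function.update x i α ∈ K i ↔ Function.update x' i (f α) ∈ K' i) :
    tupleCount x K = tupleCount x' K' := by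
  unfold tupleCount
  rw [← Set.ncard_image_of_injective _ f.injective]
  congr 1
  ext β
  obtain ⟨α, rfl⟩ := f.surjective β
  rw [f.injective.mem_set_image]
  exact forall_congr' fun i => hf α i

/-- Each class of `E'` has a representative with a partner on the left, whose `E`-class corresponds
to it; the bijection carries one count to the other. -/
theorem wlRefine_of_back_and_forth {R : (Fin m → Ω) → (Fin m → Ω') → Prop}
    (hequiv : ∀ {x x'}, R x x' →
      ∃ f : Ω ≃ Ω', ∀ α i, R (Function.update x i α) (Function.update x' i (f α)))
    (hleft : ∀ x', ∃ x, R x x') {E : Setoid (Fin m → Ω)} {E' : Setoid (Fin m → Ω')}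
    (hE : ∀ {x x' y y'}, R x x' → R y y' → (E x y ↔ E' x' y')) {x y : Fin m → Ω}
    {x' y' : Fin m → Ω'} (hx : R x x') (hy : R y y') (h : wlRefine E x y) :
    wlRefine E' x' y' := by
  refine ⟨(hE hx hy).1 h.1, fun K' hK' => ?_⟩
  choose w' hw' using hK'
  choose w hw using fun i => hleft (w' i)
  have key : ∀ {x x'}, R x x' → tupleCount x (fun i => {u | E u (w i)}) = tupleCount x' K' := by
    intro x x' hx
    obtain ⟨f, hf⟩ := hequiv hx
    refine tupleCount_eq_of_equiv f fun α i => ?_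
    rw [hw' i]
    exact hE (hf α i) (hw i)
  rw [← key hx, ← key hy]
  exact h.2 _ fun i => ⟨w i, rfl⟩

theorem IsTupleBisimulation.wlStable_iff {R : (Fin m → Ω) → (Fin m → Ω') → Prop}
    (hR : IsTupleBisimulation φ R) (hleft : ∀ x', ∃ x, R x x') (hright : ∀ x, ∃ x', R x x')
    {x y : Fin m → Ω} {x' y' : Fin m → Ω'} (hx : R x x') (hy : R y y') :
    wlStable m X x y ↔ wlStable m X' x' y' := by
  rw [_root_.wlStable_iff, _root_.wlStable_iff]
  refine forall_congr' fun k => ?_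
  induction k generalizing x y x' y' with
  | zero =>
    constructor
    · intro h i j s' hs'
      have hs := h i j _ (φ.toEquiv.symm ⟨s', hs'⟩).2
      rw [hR.rel_iff hx, hR.rel_iff hy, φ.toEquiv.apply_symm_apply] at hs
      exact hs
    · intro h i j s hs
      rw [hR.rel_iff hx i j ⟨s, hs⟩, hR.rel_iff hy i j ⟨s, hs⟩]
      exact h i j _ (φ.toEquiv ⟨s, hs⟩).2
  | succ k ih =>
    constructor
    · exact wlRefine_of_back_and_forth hR.exists_equiv hleft ih hx hy
    · refine wlRefine_of_back_and_forth (R := fun x' x => R x x') (fun {x' x} h => ?_) hright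
        (fun h h' => (ih h h').symm) hx hy
      obtain ⟨f, hf⟩ := hR.exists_equiv h
      exact ⟨f.symm, fun α i => by simpa using hf (f.symm α) i⟩

theorem IsTupleBisimulation.exists_algIso {R : (Fin m → Ω) → (Fin m → Ω') → Prop}
    (hR : IsTupleBisimulation φ R) (hleft : ∀ x', ∃ x, R x x') (hright : ∀ x, ∃ x', R x x') :
    ∃ ψ : MAryConfiguration.AlgIso (wlConfiguration m X) (wlConfiguration m X'),
      ∀ {x x'}, R x x' → ∀ K : (wlConfiguration m X).classes,
        x ∈ (K : Set (Fin m → Ω)) ↔ x' ∈ (ψ.toEquiv K : Set (Fin m → Ω')) := by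
  -- A class goes to the class of a partner of a representative; `hF` shows that neither choice
  -- matters.
  let F : (wlConfiguration m X).classes → (wlConfiguration m X').classes := fun K =>
    ⟨{x' | wlStable m X' x' (hright K.2.choose).choose}, _, rfl⟩
  have hF : ∀ {x x'}, R x x' → ∀ K : (wlConfiguration m X).classes,
      x ∈ (K : Set (Fin m → Ω)) ↔ x' ∈ (F K : Set (Fin m → Ω')) := by
    intro x x' hx K
    have hK : (K : Set (Fin m → Ω)) = {x | wlStable m X x K.2.choose} := K.2.choose_spec
    rw [hK]
    exact hR.wlStable_iff hleft hright hx (hright K.2.choose).choose_spec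
  have hbij : Function.Bijective F := by
    refine ⟨fun K L hKL => ?_, fun K' => ?_⟩
    · obtain ⟨x, hx⟩ := (wlConfiguration m X).class_nonempty K
      obtain ⟨x', hx'⟩ := hright x
      refine MAryConfiguration.class_eq_of_mem hx ((hF hx' L).2 ?_)
      rw [← hKL]
      exact (hF hx' K).1 hx
    · obtain ⟨x', hx'⟩ := (wlConfiguration m X').class_nonempty K'
      obtain ⟨x, hx⟩ := hleft x'
      obtain ⟨K, hK⟩ := (wlConfiguration m X).exists_mem_class x
      exact ⟨K, MAryConfiguration.class_eq_of_mem ((hF hx K).1 hK) hx'⟩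
  refine ⟨⟨Equiv.ofBijective F hbij, fun K σ => ?_, fun K₀ K => ?_⟩, hF⟩
  · obtain ⟨x, hx⟩ := (wlConfiguration m X).class_nonempty K
    obtain ⟨x', hx'⟩ := hright x
    exact MAryConfiguration.class_eq_of_mem ((hF (hR.comp hx' σ) _).1 ⟨x, hx, rfl⟩)
      ⟨x', (hF hx' K).1 hx, rfl⟩
  · obtain ⟨x, hx⟩ := (wlConfiguration m X).class_nonempty K₀
    obtain ⟨x', hx'⟩ := hright x
    obtain ⟨f, hf⟩ := hR.exists_equiv hx'
    exact ((wlConfiguration m X).intersectionNumber_eq K₀ K hx).trans <|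
      (tupleCount_eq_of_equiv f fun α i => hF (hf α i) (K i)).trans
        ((wlConfiguration m X').intersectionNumber_eq _ _ ((hF hx' K₀).1 hx)).symm

theorem IsTupleBisimulation.wlEquivalent {R : (Fin m → Ω) → (Fin m → Ω') → Prop}
    (hR : IsTupleBisimulation φ R) (hm : 2 ≤ m) (hleft : ∀ x', ∃ x, R x x')
    (hright : ∀ x, ∃ x', R x x') : WLEquivalent hm φ := by
  obtain ⟨ψ, hψ⟩ := hR.exists_algIso hleft hright
  refine ⟨ψ, fun s => Set.Subset.antisymm (Set.iUnion₂_subset fun K hK => ?_) fun q hq => ?_⟩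
  · rintro _ ⟨x', hx', rfl⟩
    obtain ⟨x, hx⟩ := hleft x'
    exact (hR.rel_iff hx _ _ s).1 (hK ⟨x, (hψ hx K).2 hx', rfl⟩)
  · let x' : Fin m → Ω' := fun i => if i = ⟨0, by omega⟩ then q.1 else q.2
    have hx' : (x' ⟨0, by omega⟩, x' ⟨1, by omega⟩) = q := by simp [x']
    obtain ⟨x, hx⟩ := hleft x'
    obtain ⟨K, hK⟩ := (wlConfiguration m X).exists_mem_class x
    refine Set.mem_iUnion₂.2 ⟨K, prTwo_wlClass_subset hm hK ?_, x', (hψ hx K).1 hK, hx'⟩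
    rw [hR.rel_iff hx, hx']
    exact hq

end Bisimulation

theorem mainTheorem7 {Ω Ω' : Type*} [Finite Ω] [Finite Ω'] (m : ℕ) (hm : 2 ≤ m)
    (X : CoherentConfiguration Ω) (X' : CoherentConfiguration Ω')
    (φ : CoherentConfiguration.AlgIso X X') :
    WLEquivalent hm φ ↔
      (duplicatorRel m φ).dom = Set.univ ∧ (duplicatorRel m φ).cod = Set.univ := by
  rw [Set.eq_univ_iff_forall, Set.eq_univ_iff_forall]
  constructor
  · rintro ⟨ψ, hψ⟩
    have hR := isTupleBisimulation_matches hm ψ hψ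
    exact ⟨fun x => (MAryConfiguration.AlgIso.Matches.exists_right ψ x).imp fun _ =>
        hR.mem_duplicatorRel hm,
      fun x' => (MAryConfiguration.AlgIso.Matches.exists_left ψ x').imp fun _ =>
        hR.mem_duplicatorRel hm⟩
  · rintro ⟨hdom, hcod⟩
    exact (isTupleBisimulation_duplicatorRel m φ).wlEquivalent hm hcod hdom
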